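/- Let $K$ be an algebraically closed field of characteristic $0$, let $\mathbb F=K((t^{1/\infty}))=\bigcup_{N\ge 1}K((t^{1/N}))$ be the field of Puiseux series over $K$, and let $\mathrm{val}:\mathbb F\to\mathbb R_\infty:=\mathbb R\cup\{\infty\}$ send a nonzero series to its lowest exponent and $0$ to $\infty$. Vectors $v,a\in\mathbb R_\infty^n$ are called tropically orthogonal if the minimum of the $v_i+a_i$, $1\le i\le n$, is attained for at least two indices $i$, or if $v_i+a_i=\infty$ for all $i$. For $X\subset\mathbb R_\infty^n$ let $X^\perp$ be the set of all vectors tropically orthogonal to every element of $X$, and $X^{\perp\perp}=(X^\perp)^\perp$. For $X\subset\mathbb F^n$ let $\mathrm{Trop}(X)\subset\mathbb R_\infty^n$ be the union, over all $I\subset\{1,\dots,n\}$, of the sets of all $y$ such that $y_i=\infty$ for $i\in I$ and $(y_i)_{i\notin I}$ lies in the Euclidean closure, in $\mathbb R^{\{1,\dots,n\}\setminus I}$, of $$\{(\mathrm{val}(x_i))_{i\notin I} : x\in X,\ x_i=0 \text{ for } i\in I,\ x_i\ne 0\text{ for } i\notin I\}.$$ **Theorem.** Let $P,Q\subset\mathbb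 F^n$ be linear subspaces with $\dim P=d$ and $\dim Q=n-d$, orthogonal in the sense that $\sum_i x_iy_i=0$ for all $x\in P$, $y\in Q$. Then there is a finite set $A\subset\mathbb R_\infty^n$ such that $$\mathrm{Trop}(P)=A^\perp\quad\text{and}\quad \mathrm{Trop}(Q)=A^{\perp\perp}.$$ More precisely, let $z_1,\dots,z_d$ be any basis of $P$, and for columns $k_1<\dots<k_d$ let $p_{k_1,\dots,k_d}$ be the corresponding $d\times d$ minor of the matrix with rows $z_1,\dots,z_d$. For $1\le j_1<\dots<j_{d+1}\le n$ let $\mathbf p_{j_1,\dots,j_{d+1}}\in\mathbb F^n$ be the vector whose $j_i$-th coordinate is $(-1)^i\,p_{j_1,\dots,j_{i-1},j_{i+1},\dots,j_{d+1}}$ for $1\le i\le d+1$ and whose other coordinates are $0$. Then the set $A$ of the coordinatewise valuations of all the vectors $\mathbf p_{j_1,\dots,j_{d+1}}$ is finite and satisfies both equalities. -/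

import Mathlib

/-- `ℝ ∪ {∞}` with `a + ∞ = ∞` and `a < ∞` for every real `a`. -/
abbrev RInf : Type := WithTop ℝ

namespace Puiseux

/-- The Hahn series with exponents in `ℚ` all of whose exponents lie in `(1/N)ℤ` for one positive
integer `N`. -/
def IsPuiseux {K : Type*} [Field K] (x : HahnSeries ℚ K) : Prop :=
  ∃ N : ℕ, 0 < N ∧ ∀ q ∈ x.support, ∃ k : ℤ, q = (k : ℚ) / (N : ℚ)

/-- The ordered embedding `k ↦ k / N` of `ℤ` into `ℚ`. -/
def divHom (N : ℕ) : ℤ →+ ℚ where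
  toFun k := (k : ℚ) / (N : ℚ)
  map_zero' := by simp
  map_add' a b := by push_cast; ring

theorem divHom_le {N : ℕ} (hN : 0 < N) (a b : ℤ) : divHom N a ≤ divHom N b ↔ a ≤ b := by
  have h : (0 : ℚ) < (N : ℚ) := by exact_mod_cast hN
  change (a : ℚ) / (N : ℚ) ≤ (b : ℚ) / (N : ℚ) ↔ a ≤ b
  rw [div_le_div_iff_of_pos_right h]
  exact Int.cast_le

theorem divHom_injective {N : ℕ} (hN : 0 < N) : Function.Injective (divHom N) := fun a b h =>
  le_antisymm ((divHom_le hN a b).1 h.le) ((divHom_le hN b a).1 h.ge)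

/-- The embedding of `K((t))` into Hahn series that sends `t` to `t^(1/N)`. -/
noncomputable def ramify (K : Type*) [Field K] {N : ℕ} (hN : 0 < N) :
    HahnSeries ℤ K →+* HahnSeries ℚ K :=
  HahnSeries.embDomainRingHom (divHom N) (divHom_injective hN) (divHom_le hN)

theorem exists_ramify {K : Type*} [Field K] {N : ℕ} (hN : 0 < N) (x : HahnSeries ℚ K)
    (h : ∀ q ∈ x.support, ∃ k : ℤ, q = (k : ℚ) / (N : ℚ)) :
    ∃ a : HahnSeries ℤ K, ramify K hN a = x := by
  refine ⟨⟨fun k => x.coeff (divHom N k), ?_⟩, ?_⟩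
  · intro f
    obtain ⟨a, b, hab, hle⟩ := x.isPWO_support (fun i => ⟨divHom N (f i).1, (f i).2⟩)
    exact ⟨a, b, hab, (divHom_le hN _ _).1 hle⟩
  · ext q
    by_cases hq : q ∈ Set.range (divHom N)
    · obtain ⟨k, rfl⟩ := hq
      exact HahnSeries.embDomain_coeff
    · have h1 : x.coeff q = 0 := by
        by_contra hne
        obtain ⟨k, hk⟩ := h q hne
        exact hq ⟨k, hk.symm⟩
      rw [h1]
      exact HahnSeries.embDomain_of_notMem_range hq

theorem isPuiseux_iff {K : Type*} [Field K] (x : HahnSeries ℚ K) :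
    IsPuiseux x ↔ ∃ (N : ℕ) (hN : 0 < N), ∃ y : HahnSeries ℤ K, ramify K hN y = x := by
  constructor
  · rintro ⟨N, hN, h⟩
    exact ⟨N, hN, exists_ramify hN x h⟩
  · rintro ⟨N, hN, y, rfl⟩
    refine ⟨N, hN, fun q hq => ?_⟩
    by_contra hne
    refine hq (HahnSeries.embDomain_of_notMem_range ?_)
    rintro ⟨k, hk⟩
    exact hne ⟨k, hk.symm⟩

theorem IsPuiseux.common {K : Type*} [Field K] {x y : HahnSeries ℚ K}
    (hx : IsPuiseux x) (hy : IsPuiseux y) :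
    ∃ (N : ℕ) (hN : 0 < N), ∃ a b : HahnSeries ℤ K, ramify K hN a = x ∧ ramify K hN b = y := by
  have key : ∀ (M L : ℕ), 0 < M → 0 < L → ∀ k : ℤ,
      (k : ℚ) / (M : ℚ) = ((k * L : ℤ) : ℚ) / ((M * L : ℕ) : ℚ) := by
    intro M L hM hL k
    have h1 : (M : ℚ) ≠ 0 := by exact_mod_cast hM.ne'
    have h2 : (L : ℚ) ≠ 0 := by exact_mod_cast hL.ne'
    push_cast
    field_simp
  obtain ⟨M, hM, h1⟩ := hx
  obtain ⟨L, hL, h2⟩ := hy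
  obtain ⟨a, ha⟩ := exists_ramify (Nat.mul_pos hM hL) x (fun q hq => by
    obtain ⟨k, rfl⟩ := h1 q hq
    exact ⟨_, key M L hM hL k⟩)
  obtain ⟨b, hb⟩ := exists_ramify (Nat.mul_pos hM hL) y (fun q hq => by
    obtain ⟨k, rfl⟩ := h2 q hq
    exact ⟨k * M, by rw [Nat.mul_comm M L]; exact key L M hL hM k⟩)
  exact ⟨M * L, Nat.mul_pos hM hL, a, b, ha, hb⟩

/-- The field `K((t^(1/∞)))` of Puiseux series, as a subfield of the Hahn series. -/
noncomputable def puiseuxSubfield (K : Type*) [Field K] : Subfield (HahnSeries ℚ K) where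
  carrier := {x | IsPuiseux x}
  one_mem' := (isPuiseux_iff _).2 ⟨1, one_pos, 1, map_one _⟩
  zero_mem' := (isPuiseux_iff _).2 ⟨1, one_pos, 0, map_zero _⟩
  mul_mem' := by
    intro x y hx hy
    obtain ⟨N, hN, a, b, rfl, rfl⟩ := IsPuiseux.common hx hy
    exact (isPuiseux_iff _).2 ⟨N, hN, a * b, map_mul _ _ _⟩
  add_mem' := by
    intro x y hx hy
    obtain ⟨N, hN, a, b, rfl, rfl⟩ := IsPuiseux.common hx hy
    exact (isPuiseux_iff _).2 ⟨N, hN, a + b, map_add _ _ _⟩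
  neg_mem' := by
    intro x hx
    obtain ⟨N, hN, a, rfl⟩ := (isPuiseux_iff _).1 hx
    exact (isPuiseux_iff _).2 ⟨N, hN, -a, map_neg _ _⟩
  inv_mem' := by
    intro x hx
    obtain ⟨N, hN, a, rfl⟩ := (isPuiseux_iff _).1 hx
    exact (isPuiseux_iff _).2 ⟨N, hN, a⁻¹, map_inv₀ _ _⟩

end Puiseux

/-- The field `K((t^(1/∞)))` of Puiseux series over `K`. -/
abbrev PuiseuxSeries (K : Type*) [Field K] : Type _ := ↥(Puiseux.puiseuxSubfield K)

namespace TropLin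

/-- The valuation of a Puiseux series: its lowest exponent, and `∞` for the zero series. -/
noncomputable def val {K : Type*} [Field K] (x : PuiseuxSeries K) : RInf :=
  (x : HahnSeries ℚ K).orderTop.map (fun q : ℚ => (q : ℝ))

/-- Tropical orthogonality: the minimum of the `v i + a i` is attained at least twice, or all of
them are `∞` (the second alternative matters only for a vector of length at most one, where it
says that `(∞)` is orthogonal to everything). -/
def Orthogonal {n : ℕ} (v a : Fin n → RInf) : Prop :=
  (∃ i j : Fin n, i ≠ j ∧ (∀ k, v i + a i ≤ v k + a k) ∧ (∀ k, v j + a j ≤ v k + a k)) ∨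
    ∀ i, v i + a i = ⊤

/-- `X^⊥`: all vectors that are tropically orthogonal to every vector of `X`. -/
def perp {n : ℕ} (X : Set (Fin n → RInf)) : Set (Fin n → RInf) :=
  {v | ∀ a ∈ X, Orthogonal v a}

/-- The chart of `F^n` in which exactly the coordinates in `I` vanish. -/
def chart (K : Type*) [Field K] {n : ℕ} (I : Set (Fin n)) : Set (Fin n → PuiseuxSeries K) :=
  {x | ∀ i, x i = 0 ↔ i ∈ I}

/-- The tropicalization of `X ∩ D_I`: the coordinates in `I` are `∞`, and the others form a point
of the Euclidean closure of the set of valuation vectors of the points of `X ∩ D_I`. -/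
def tropChart {K : Type*} [Field K] {n : ℕ} (X : Set (Fin n → PuiseuxSeries K))
    (I : Set (Fin n)) : Set (Fin n → RInf) :=
  {y | (∀ i ∈ I, y i = ⊤) ∧
    ∃ w ∈ closure {u : {i : Fin n // i ∉ I} → ℝ |
        ∃ x ∈ X ∩ chart K I, ∀ i : {i : Fin n // i ∉ I}, val (x i) = (u i : RInf)},
      ∀ i : {i : Fin n // i ∉ I}, y i = (w i : RInf)}

/-- The tropicalization of a subset of `F^n`. -/
def Trop {K : Type*} [Field K] {n : ℕ} (X : Set (Fin n → PuiseuxSeries K)) :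
    Set (Fin n → RInf) :=
  ⋃ I : Set (Fin n), tropChart X I

/-- The circuit vector of the columns `j 0 < ⋯ < j d`: up to sign, its coordinate at `j i` is the
minor of the matrix with rows `z` on the other `d` columns; the coordinates off the columns `j`
are `0`. Counting from zero, the sign at `j i` is `(-1)^(i+1)`. -/
noncomputable def circuitVector {K : Type*} [Field K] {n d : ℕ}
    (z : Fin d → Fin n → PuiseuxSeries K) (j : Fin (d + 1) ↪o Fin n) : Fin n → PuiseuxSeries K :=
  ∑ i : Fin (d + 1), Pi.single (j i)
    ((-1) ^ ((i : ℕ) + 1) *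
      (Matrix.of fun k l : Fin d => z k (j (i.succAbove l))).det)

/-- The coordinatewise valuations of all circuit vectors of the matrix with rows `z`. -/
noncomputable def circuitVals {K : Type*} [Field K] {n d : ℕ}
    (z : Fin d → Fin n → PuiseuxSeries K) : Set (Fin n → RInf) :=
  {a | ∃ j : Fin (d + 1) ↪o Fin n, a = fun m => val (circuitVector z j m)}

end TropLin

/-! By dimension, `Q` is the dot-product complement of `P`. Two facts carry the proof.

First (`trop_dotCompl`), for a subspace W with complement W', Trop(W') = val(W)^⊥. In a vanishing
sum no single term has strictly least valuation; a strict minimum is an open condition, so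
orthogonality survives the closure. Conversely, let y be orthogonal to val(W), and let U be the
vectors of W' vanishing where y = ∞. U has an echelon basis v_b with val(v_b k) + y_b ≥ y_k
(`exists_weighted_echelon`). If equality failed for all b at some finite y_k, the relation x_k = Σ
x_b v_b(k) on U would yield a vector of W with a strict minimum against y
(`exists_echelon_eq_weight`). Scaling each v_b by a series of valuation close to y_b and combining
without cancellation (`exists_mem_val_eq_inf`) gives points of U with valuations close to y.

Second (`perp_circuitVals`), circuits test orthogonality to the whole complement: a vector with a
strict minimum against y can be shrunk in support, keeping that minimum, until it is a multiple of a
circuit vector.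

Hence Trop(P) = A^⊥. As Trop(P) and val(P) have the same perp (`perp_trop`), A^⊥⊥ = val(P)^⊥ =
Trop(Q). -/

namespace TropLin

/-! ### The valuation, and combinations without cancellation -/

section Valuation

variable {K : Type*} [Field K]

theorem val_eq_top {x : PuiseuxSeries K} : val x = ⊤ ↔ x = 0 := by
  simp [val, WithTop.map_eq_top_iff]

@[simp] theorem val_zero : val (0 : PuiseuxSeries K) = ⊤ := val_eq_top.2 rfl

theorem val_mul (x y : PuiseuxSeries K) : val (x * y) = val x + val y := by
  have h : ((x * y : PuiseuxSeries K) : HahnSeries ℚ K).orderTop =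
      (x : HahnSeries ℚ K).orderTop + (y : HahnSeries ℚ K).orderTop :=
    HahnSeries.orderTop_mul _ _
  unfold val
  rw [h]
  exact WithTop.map_add (Rat.castHom ℝ).toAddMonoidHom _ _

theorem monotone_map_ratCast : Monotone (WithTop.map (fun q : ℚ => (q : ℝ))) :=
  Monotone.withTop_map Rat.cast_mono

theorem min_le_val_add (x y : PuiseuxSeries K) : min (val x) (val y) ≤ val (x + y) := by
  have h := monotone_map_ratCast
    (HahnSeries.min_orderTop_le_orderTop_add (x := (x : HahnSeries ℚ K)) (y := (y : HahnSeries ℚ K)))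
  rw [monotone_map_ratCast.map_min] at h
  exact h

@[simp] theorem val_neg (x : PuiseuxSeries K) : val (-x) = val x := by
  have h : ((-x : PuiseuxSeries K) : HahnSeries ℚ K).orderTop = (x : HahnSeries ℚ K).orderTop :=
    HahnSeries.orderTop_neg
  unfold val
  rw [h]

@[simp] theorem val_one : val (1 : PuiseuxSeries K) = 0 := by
  have h : ((1 : PuiseuxSeries K) : HahnSeries ℚ K).orderTop = 0 := HahnSeries.orderTop_one
  unfold val
  rw [h]
  exact congrArg _ Rat.cast_zero

theorem lt_val_add {r : RInf} {x y : PuiseuxSeries K} (hx : r < val x) (hy : r < val y) :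
    r < val (x + y) :=
  (lt_min hx hy).trans_le (min_le_val_add x y)

theorem le_val_add {r : RInf} {x y : PuiseuxSeries K} (hx : r ≤ val x) (hy : r ≤ val y) :
    r ≤ val (x + y) :=
  (le_min hx hy).trans (min_le_val_add x y)

theorem le_val_sub {r : RInf} {x y : PuiseuxSeries K} (hx : r ≤ val x) (hy : r ≤ val y) :
    r ≤ val (x - y) := by
  rw [sub_eq_add_neg]
  exact le_val_add hx (by simpa using hy)

theorem lt_val_sub {r : RInf} {x y : PuiseuxSeries K} (hx : r < val x) (hy : r < val y) :
    r < val (x - y) := by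
  rw [sub_eq_add_neg]
  exact lt_val_add hx (by simpa using hy)

theorem le_val_sum {ι : Type*} {r : RInf} {s : Finset ι} {f : ι → PuiseuxSeries K}
    (h : ∀ i ∈ s, r ≤ val (f i)) : r ≤ val (∑ i ∈ s, f i) :=
  Finset.sum_induction f (fun x => r ≤ val x) (fun _ _ => le_val_add) (by simp) h

theorem lt_val_sum {ι : Type*} {r : RInf} {s : Finset ι} {f : ι → PuiseuxSeries K}
    (hr : r ≠ ⊤) (h : ∀ i ∈ s, r < val (f i)) : r < val (∑ i ∈ s, f i) :=
  Finset.sum_induction f (fun x => r < val x) (fun _ _ => lt_val_add)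
    (by simpa using hr.lt_top) h

theorem val_sub_eq_of_lt {x y : PuiseuxSeries K} (h : val x < val y) : val (x - y) = val x := by
  refine le_antisymm ?_ (le_val_sub le_rfl h.le)
  by_contra! hlt
  have := lt_val_add hlt h
  simp at this

/-- In characteristic 0 a nonzero integer is a nonzero constant series. This makes integers usable
as generic coefficients. -/
theorem val_intCast [CharZero K] {m : ℤ} (hm : m ≠ 0) : val (m : PuiseuxSeries K) = 0 := by
  have h : ((m : PuiseuxSeries K) : HahnSeries ℚ K).orderTop = 0 := by
    have h1 : ((m : PuiseuxSeries K) : HahnSeries ℚ K) = HahnSeries.C (m : K) := by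
      rw [map_intCast]; rfl
    rw [h1]
    exact HahnSeries.orderTop_single (Int.cast_ne_zero.2 hm)
  unfold val
  rw [h]
  exact congrArg _ Rat.cast_zero

theorem exists_val_eq_ratCast (K : Type*) [Field K] (q : ℚ) :
    ∃ t : PuiseuxSeries K, val t = ((q : ℝ) : RInf) := by
  refine ⟨⟨HahnSeries.single q 1, q.den, q.pos, fun p hp => ⟨q.num, ?_⟩⟩, ?_⟩
  · rw [HahnSeries.support_single_of_ne one_ne_zero] at hp
    rw [Set.mem_singleton_iff.1 hp, Rat.num_div_den]
  · unfold val
    rw [HahnSeries.orderTop_single one_ne_zero]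
    rfl

theorem exists_val_eq_coe {x : PuiseuxSeries K} (hx : x ≠ 0) : ∃ r : ℝ, val x = (r : RInf) :=
  ⟨_, (WithTop.coe_untop _ (mt val_eq_top.1 hx)).symm⟩

/-- An integer combination of two vectors in which no leading terms cancel. -/
theorem exists_int_val_add_le [CharZero K] {ι : Type*} [Finite ι] (u v : ι → PuiseuxSeries K) :
    ∃ m : ℤ, ∀ k, val (u k + (m : PuiseuxSeries K) * v k) ≤ min (val (u k)) (val (v k)) := by
  -- For each k at most one m is bad: two bad values push the valuation of (m - m') v_k, hence of
  -- v_k, and then that of u_k, above the minimum of the two. Finitely many k exclude only finitely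
  -- many integers.
  have hsub : ∀ k, {m : ℤ | ¬ val (u k + (m : PuiseuxSeries K) * v k) ≤ min (val (u k)) (val (v k))}.Subsingleton := by
    intro k m hm m' hm'
    by_contra hne
    simp only [Set.mem_ofPred_eq, not_le] at hm hm'
    have h1 := lt_val_sub hm hm'
    have h2 : u k + (m : PuiseuxSeries K) * v k - (u k + (m' : PuiseuxSeries K) * v k) = ((m - m' : ℤ) : PuiseuxSeries K) * v k := by
      push_cast; ring
    rw [h2, val_mul, val_intCast (sub_ne_zero.2 hne), zero_add] at h1
    have h3 : min (val (u k)) (val (v k)) < val ((m : PuiseuxSeries K) * v k) := by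
      rw [val_mul]
      by_cases h0 : m = 0
      · simp only [h0, Int.cast_zero, val_zero, top_add]
        exact h1.trans_le le_top
      · rwa [val_intCast h0, zero_add]
    have h4 := lt_val_sub hm h3
    rw [add_sub_cancel_right] at h4
    exact (lt_min h4 h1).false
  have hfin := Set.finite_iUnion fun k => (hsub k).finite
  obtain ⟨m, hm⟩ := hfin.exists_notMem
  refine ⟨m, fun k => ?_⟩
  by_contra h
  exact hm (Set.mem_iUnion.2 ⟨k, h⟩)

/-- Finitely many vectors of a subspace have a combination in which no leading terms cancel. -/
theorem exists_mem_val_eq_inf [CharZero K] {ι κ : Type*} [Finite ι]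
    (W : Submodule (PuiseuxSeries K) (ι → PuiseuxSeries K)) (v : κ → ι → PuiseuxSeries K)
    (B : Finset κ) (hv : ∀ b ∈ B, v b ∈ W) :
    ∃ x ∈ W, ∀ k, (val (x k)) = B.inf fun b => val (v b k) := by
  classical
  induction B using Finset.induction_on with
  | empty => exact ⟨0, W.zero_mem, by simp⟩
  | insert a B ha ih =>
    obtain ⟨x, hx, hxk⟩ := ih fun b hb => hv b (Finset.mem_insert_of_mem hb)
    obtain ⟨m, hm⟩ := exists_int_val_add_le x (v a)
    refine ⟨x + (m : PuiseuxSeries K) • v a,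
      W.add_mem hx (W.smul_mem _ (hv a (Finset.mem_insert_self _ _))), fun k => ?_⟩
    rw [Finset.inf_insert, ← hxk k, inf_comm]
    refine le_antisymm (hm k) (le_val_add inf_le_left ?_)
    change _ ≤ val ((m : PuiseuxSeries K) * v a k)
    rw [val_mul]
    by_cases h0 : m = 0
    · simp [h0]
    · rw [val_intCast h0, zero_add]
      exact inf_le_right

end Valuation

/-! ### Tropical orthogonality -/

section Orthogonality

variable {n : ℕ}

theorem orthogonal_comm {v a : Fin n → RInf} : Orthogonal v a ↔ Orthogonal a v := by
  simp only [Orthogonal, add_comm]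

/-- Failure of orthogonality as a strict finite minimum: the form in which it is used throughout,
being stable under small changes and under the ultrametric inequality. -/
theorem not_orthogonal_iff {v a : Fin n → RInf} :
    ¬ Orthogonal v a ↔ ∃ i, v i + a i ≠ ⊤ ∧ ∀ k, k ≠ i → v i + a i < v k + a k := by
  constructor
  · intro h
    simp only [Orthogonal, not_or, not_forall] at h
    obtain ⟨h1, i₀, h2⟩ := h
    obtain ⟨i, -, hi⟩ := Finset.exists_min_image Finset.univ (fun k => v k + a k)
      ⟨i₀, Finset.mem_univ _⟩
    refine ⟨i, fun h => h2 (top_le_iff.1 (h ▸ hi i₀ (Finset.mem_univ _))), fun k hk => ?_⟩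
    by_contra! hle
    exact h1 ⟨i, k, hk.symm, fun l => hi l (Finset.mem_univ _),
      fun l => hle.trans (hi l (Finset.mem_univ _))⟩
  · rintro ⟨i, hi, h⟩ (⟨j, k, hjk, hj, hk⟩ | h')
    · by_cases hji : j = i
      · exact (h k (by rintro rfl; exact hjk hji)).not_ge (hk i)
      · exact (h j hji).not_ge (hj i)
    · exact hi (h' i)

end Orthogonality


/-! ### Linear dependences and dot-product complements -/

section LinearAlgebra

/-- Coefficient families become vectors indexed by all columns, so that dependences between columns
of a matrix are the vectors orthogonal to its rows. -/
theorem linearIndepOn_iff_of_fintype {ι F V : Type*} [Fintype ι] [Field F] [AddCommGroup V]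
    [Module F V] {v : ι → V} {s : Set ι} :
    LinearIndepOn F v s ↔
      ∀ e : ι → F, (∀ m, m ∉ s → e m = 0) → ∑ m, e m • v m = 0 → e = 0 := by
  rw [linearIndepOn_iff]
  constructor
  · intro h e he h0
    have h1 := h (Finsupp.equivFunOnFinite.symm e)
      ((Finsupp.mem_supported' F _).2 fun m hm => he m hm)
      (by rw [Finsupp.linearCombination_apply, Finsupp.sum_fintype _ _ (by simp)]; exact h0)
    ext m
    exact DFunLike.congr_fun h1 m
  · intro h l hl h0
    have h1 := h l (fun m hm => (Finsupp.mem_supported' F _).1 hl m hm)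
      (by rwa [Finsupp.linearCombination_apply, Finsupp.sum_fintype _ _ (by simp)] at h0)
    ext m
    exact congrFun h1 m

theorem dotProductBilin_nondegenerate (F : Type*) [Field F] (n : ℕ) :
    LinearMap.BilinForm.Nondegenerate (dotProductBilin F F : LinearMap.BilinForm F (Fin n → F)) := by
  constructor
  · intro x hx
    exact dotProduct_eq_zero_iff.1 hx
  · intro x hx
    exact dotProduct_eq_zero_iff.1 fun y => (dotProduct_comm _ _).trans (hx y)

theorem dotProductBilin_isRefl (F : Type*) [Field F] (n : ℕ) :
    LinearMap.BilinForm.IsRefl (dotProductBilin F F : LinearMap.BilinForm F (Fin n → F)) :=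
  fun x y h => (dotProduct_comm y x).trans h

/-- The orthogonal complement with respect to the dot product. -/
noncomputable def dotCompl {F : Type*} [Field F] {n : ℕ} (W : Submodule F (Fin n → F)) :
    Submodule F (Fin n → F) :=
  LinearMap.BilinForm.orthogonal (dotProductBilin F F) W

theorem mem_dotCompl {F : Type*} [Field F] {n : ℕ} {W : Submodule F (Fin n → F)} {x : Fin n → F} :
    x ∈ dotCompl W ↔ ∀ y ∈ W, y ⬝ᵥ x = 0 :=
  Iff.rfl

theorem dotCompl_dotCompl {F : Type*} [Field F] {n : ℕ} (W : Submodule F (Fin n → F)) :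
    dotCompl (dotCompl W) = W :=
  LinearMap.BilinForm.orthogonal_orthogonal (dotProductBilin_nondegenerate F n)
    (dotProductBilin_isRefl F n) W

theorem finrank_dotCompl {F : Type*} [Field F] {n : ℕ} (W : Submodule F (Fin n → F)) :
    Module.finrank F (dotCompl W) = n - Module.finrank F W := by
  rw [dotCompl, LinearMap.BilinForm.finrank_orthogonal (dotProductBilin_nondegenerate F n),
    Module.finrank_fin_fun]

end LinearAlgebra

/-! ### Circuit vectors and their tropical orthogonal complement -/

section Circuits

variable {K : Type*} [Field K] {n d : ℕ}

theorem circuitVector_apply_self (z : Fin d → Fin n → PuiseuxSeries K)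
    (j : Fin (d + 1) ↪o Fin n) (i : Fin (d + 1)) :
    circuitVector z j (j i) = (-1) ^ ((i : ℕ) + 1) *
      (Matrix.of fun k l : Fin d => z k (j (i.succAbove l))).det := by
  rw [circuitVector, Finset.sum_apply, Finset.sum_eq_single i]
  · exact Pi.single_eq_same _ _
  · intro b _ hb
    exact Pi.single_eq_of_ne (fun h => hb (j.injective h).symm) _
  · simp

theorem circuitVector_apply_of_notMem (z : Fin d → Fin n → PuiseuxSeries K)
    (j : Fin (d + 1) ↪o Fin n) {m : Fin n} (hm : m ∉ Set.range j) :
    circuitVector z j m = 0 := by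
  rw [circuitVector, Finset.sum_apply]
  exact Finset.sum_eq_zero fun i _ => Pi.single_eq_of_ne (fun h => hm ⟨i, h.symm⟩) _

/-- Up to a global sign this is the Laplace expansion, along the first row, of a determinant in
which row k of `z` occurs twice. -/
theorem dotProduct_circuitVector (z : Fin d → Fin n → PuiseuxSeries K)
    (j : Fin (d + 1) ↪o Fin n) (k : Fin d) : z k ⬝ᵥ circuitVector z j = 0 := by
  have h : (Matrix.of (Fin.cons (fun i => z k (j i)) fun l i => z l (j i)) :
      Matrix (Fin (d + 1)) (Fin (d + 1)) (PuiseuxSeries K)).det = 0 :=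
    Matrix.det_zero_of_row_eq (i := 0) (j := k.succ) (Fin.succ_ne_zero k).symm (by ext; simp)
  rw [Matrix.det_succ_row_zero] at h
  rw [circuitVector, dotProduct_sum, ← neg_eq_zero, ← h, ← Finset.sum_neg_distrib]
  refine Finset.sum_congr rfl fun i _ => ?_
  rw [dotProduct_single]
  have hm : (Matrix.of (Fin.cons (fun i => z k (j i)) fun l i => z l (j i)) :
      Matrix (Fin (d + 1)) (Fin (d + 1)) (PuiseuxSeries K)).submatrix Fin.succ i.succAbove =
      Matrix.of fun k l : Fin d => z k (j (i.succAbove l)) := by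
    ext; simp
  rw [hm, pow_succ]
  simp only [Matrix.of_apply, Fin.cons_zero]
  ring

/-- A vector of minimal support in the orthogonal complement of the rows of `z` is a multiple of a
circuit vector. -/
theorem exists_eq_smul_circuitVector {z : Fin d → Fin n → PuiseuxSeries K}
    (hz : LinearIndependent (PuiseuxSeries K) z) {c : Fin n → PuiseuxSeries K}
    (hc : ∀ k, z k ⬝ᵥ c = 0) (hc0 : c ≠ 0)
    (hmin : ∀ e : Fin n → PuiseuxSeries K, (∀ k, z k ⬝ᵥ e = 0) → (∀ m, c m = 0 → e m = 0) →
      (∃ m, c m ≠ 0 ∧ e m = 0) → e = 0) :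
    ∃ j : Fin (d + 1) ↪o Fin n, ∃ r : PuiseuxSeries K, r ≠ 0 ∧ c = r • circuitVector z j := by
  classical
  let col : Fin n → Fin d → PuiseuxSeries K := fun m k => z k m
  have hdot : ∀ e : Fin n → PuiseuxSeries K, ∑ m, e m • col m = 0 ↔ ∀ k, z k ⬝ᵥ e = 0 := by
    intro e
    rw [funext_iff]
    refine forall_congr' fun k => ?_
    simp [dotProduct, col, Finset.sum_apply, mul_comm]
  obtain ⟨s, hs⟩ := Function.ne_iff.1 hc0
  replace hs : c s ≠ 0 := hs
  -- By minimality, a dependence supported in the support of c and vanishing at s is zero.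
  have hT : LinearIndepOn (PuiseuxSeries K) col {m | c m ≠ 0 ∧ m ≠ s} := by
    rw [linearIndepOn_iff_of_fintype]
    intro e he h0
    refine hmin e ((hdot e).1 h0) (fun m hm => he m fun h => h.1 hm) ⟨s, hs, he s fun h => h.2 rfl⟩
  -- B is a basis of the column space containing the support of c except s. Since the rank is d, the
  -- set B ∪ {s} has d + 1 elements and serves as the column set j.
  have hTB := hT.subset_extend (Set.subset_univ _)
  have hBli := hT.linearIndepOn_extend (Set.subset_univ _)
  have hBspan := hT.span_image_extend_eq_span_image (Set.subset_univ _)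
  generalize hT.extend (Set.subset_univ _) = B at hTB hBli hBspan
  have hB0 := linearIndepOn_iff_of_fintype.1 hBli
  have hcB : ∀ m, m ∉ B → m ≠ s → c m = 0 := by
    intro m hm hms
    by_contra h
    exact hm (hTB ⟨h, hms⟩)
  have hsB : s ∉ B := fun h => hc0 <| hB0 c
    (fun m hm => hcB m hm fun hms => hm (hms ▸ h)) ((hdot c).2 hc)
  have hcard : B.toFinset.card = d := by
    have hspan : Submodule.span (PuiseuxSeries K) (Set.range col) = ⊤ := by
      refine Submodule.eq_top_of_finrank_eq ?_
      have h1 := LinearIndependent.rank_matrix (M := Matrix.of z) hz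
      rw [Matrix.rank_eq_finrank_span_cols, Fintype.card_fin] at h1
      rw [Module.finrank_fin_fun]
      exact h1
    rw [Set.image_univ, hspan] at hBspan
    have b := Module.Basis.mk (v := fun m : B => col m) hBli (by
      rw [← hBspan, Set.image_eq_range])
    have := Module.finrank_eq_card_basis b
    rw [Module.finrank_fin_fun] at this
    rw [Set.toFinset_card, ← this]
  have hJ : (insert s B.toFinset).card = d + 1 := by
    rw [Finset.card_insert_of_notMem (by simpa using hsB), hcard]
  let j := (insert s B.toFinset).orderEmbOfFin hJ
  have hrange : Set.range j = insert s B := by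
    rw [Finset.range_orderEmbOfFin]
    simp
  obtain ⟨i, hi⟩ : s ∈ Set.range j := hrange ▸ Set.mem_insert s B
  have hmem : ∀ l, j (i.succAbove l) ∈ B := by
    intro l
    have h1 : j (i.succAbove l) ∈ insert s B := hrange ▸ Set.mem_range_self _
    refine h1.resolve_left fun h2 => Fin.succAbove_ne i l (j.injective (h2.trans hi.symm))
  -- The entry at s is, up to sign, the minor on the basis B.
  have hcv : circuitVector z j s ≠ 0 := by
    rw [← hi, circuitVector_apply_self]
    refine mul_ne_zero (pow_ne_zero _ (neg_ne_zero.2 one_ne_zero)) ?_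
    have hli : LinearIndependent (PuiseuxSeries K)
        (Matrix.of fun k l : Fin d => z k (j (i.succAbove l))).col :=
      LinearIndependent.comp hBli (fun l : Fin d => (⟨j (i.succAbove l), hmem l⟩ : B))
        fun a b hab => Fin.succAbove_right_injective (p := i) (j.injective (Subtype.mk.inj hab))
    exact ((Matrix.isUnit_iff_isUnit_det _).1
      (Matrix.linearIndependent_cols_iff_isUnit.1 hli)).ne_zero
  refine ⟨j, c s / circuitVector z j s, div_ne_zero hs hcv, ?_⟩
  -- The difference is a dependence between columns; it vanishes at s, hence is supported on the
  -- independent set B.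
  rw [← sub_eq_zero]
  refine hB0 _ (fun m hm => ?_) ((hdot _).2 fun k => ?_)
  · by_cases hms : m = s
    · subst hms
      simp [div_mul_cancel₀ _ hcv]
    · have h1 : m ∉ Set.range j := by
        rw [hrange]
        exact fun h => h.elim hms hm
      simp [circuitVector_apply_of_notMem z j h1, hcB m hm hms]
  · rw [dotProduct_sub, dotProduct_smul, hc, dotProduct_circuitVector, smul_zero, sub_zero]

theorem finite_circuitVals (z : Fin d → Fin n → PuiseuxSeries K) : (circuitVals z).Finite := by
  have : Finite (Fin (d + 1) ↪o Fin n) := DFunLike.finite _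
  refine (Set.finite_range fun j : Fin (d + 1) ↪o Fin n =>
    fun m => val (circuitVector z j m)).subset ?_
  rintro a ⟨j, rfl⟩
  exact ⟨j, rfl⟩

/-- The coordinatewise valuations of the vectors of a set. -/
noncomputable def valSet (X : Set (Fin n → PuiseuxSeries K)) : Set (Fin n → RInf) :=
  (fun x m => val (x m)) '' X

/-- Circuit elimination by induction on the support: subtracting a well-chosen multiple of a vector
of smaller support either preserves the strict minimum or shows that the multiple itself has it. -/
theorem exists_circuitVector_not_orthogonal {z : Fin d → Fin n → PuiseuxSeries K}
    (hz : LinearIndependent (PuiseuxSeries K) z) (y : Fin n → RInf)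
    (c : Fin n → PuiseuxSeries K) (hc : ∀ k, z k ⬝ᵥ c = 0)
    (hyc : ¬ Orthogonal y fun m => val (c m)) :
    ∃ j : Fin (d + 1) ↪o Fin n, ¬ Orthogonal y fun m => val (circuitVector z j m) := by
  classical
  induction hN : (Finset.univ.filter fun m => c m ≠ 0).card using Nat.strong_induction_on
    generalizing c with
  | _ N ih =>
  subst hN
  have hlt : ∀ e : Fin n → PuiseuxSeries K, (∀ m, c m = 0 → e m = 0) →
      (∃ m, c m ≠ 0 ∧ e m = 0) → (Finset.univ.filter fun m => e m ≠ 0).card <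
        (Finset.univ.filter fun m => c m ≠ 0).card := by
    rintro e he ⟨m, hm, hem⟩
    refine Finset.card_lt_card (Finset.ssubset_iff_of_subset (fun k hk => ?_) |>.2 ⟨m, ?_, ?_⟩)
    · simp only [Finset.mem_filter, Finset.mem_univ, true_and] at hk ⊢
      exact mt (he k) hk
    · simpa using hm
    · simpa using hem
  obtain ⟨i, hi, hik⟩ := not_orthogonal_iff.1 hyc
  rw [WithTop.add_ne_top] at hi
  have hc0 : c ≠ 0 := by
    rintro rfl
    exact hi.2 (by simp)
  by_cases hmin : ∀ e : Fin n → PuiseuxSeries K, (∀ k, z k ⬝ᵥ e = 0) → (∀ m, c m = 0 → e m = 0) →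
      (∃ m, c m ≠ 0 ∧ e m = 0) → e = 0
  · obtain ⟨j, r, hr, rfl⟩ := exists_eq_smul_circuitVector hz hc hc0 hmin
    refine ⟨j, not_orthogonal_iff.2 ⟨i, ?_, fun k hk => ?_⟩⟩
    · have h2 := hi.2
      simp only [Pi.smul_apply, smul_eq_mul, val_mul] at h2
      exact WithTop.add_ne_top.2 ⟨hi.1, (WithTop.add_ne_top.1 h2).2⟩
    · have h := hik k hk
      simp only [Pi.smul_apply, smul_eq_mul, val_mul] at h
      rw [add_left_comm, add_left_comm (y k)] at h
      exact lt_of_add_lt_add_left h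
  · push Not at hmin
    obtain ⟨e, hze, hce, ⟨m, hcm, hem⟩, he0⟩ := hmin
    obtain ⟨s, hs⟩ := Function.ne_iff.1 he0
    -- Maximality of val(c_k / e_k) at j makes val(c_k) ≤ val(r e_k) for all k, while c - r e loses
    -- the coordinate j. The default 0 is never taken, as e_k ≠ 0 forces c_k ≠ 0.
    obtain ⟨j, hj, hmax⟩ := Finset.exists_max_image (Finset.univ.filter fun m => e m ≠ 0)
      (fun k => (val (c k / e k)).untopD 0) ⟨s, by simpa using hs⟩
    simp only [Finset.mem_filter, Finset.mem_univ, true_and] at hj hmax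
    have hcj : c j ≠ 0 := mt (hce j) hj
    set r := c j / e j with hr
    have hr0 : r ≠ 0 := div_ne_zero hcj hj
    have hle : ∀ k, val (c k) ≤ val (r * e k) := by
      intro k
      by_cases hk : e k = 0
      · simp [hk]
      · have h1 := hmax k hk
        obtain ⟨a, ha⟩ := exists_val_eq_coe (div_ne_zero (mt (hce k) hk) hk)
        obtain ⟨b, hb⟩ := exists_val_eq_coe hr0
        rw [ha, hb, WithTop.untopD_coe, WithTop.untopD_coe] at h1
        calc val (c k) = val (c k / e k) + val (e k) := by rw [← val_mul, div_mul_cancel₀ _ hk]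
          _ ≤ val r + val (e k) := by
            rw [ha, hb]
            exact add_le_add_left (WithTop.coe_le_coe.2 h1) _
          _ = val (r * e k) := (val_mul _ _).symm
    have horth : ∀ (q : PuiseuxSeries K) (k : Fin d), z k ⬝ᵥ (q • e) = 0 := fun q k => by
      rw [dotProduct_smul, hze, smul_zero]
    -- If the inequality at i is strict, c - r e keeps the valuation of c at i and has none lower
    -- than c elsewhere. If it is an equality, r e has these properties, and it misses the
    -- coordinate m.
    rcases (hle i).lt_or_eq with hlti | heq
    · refine ih _ (hlt (c - r • e) ?_ ⟨j, hcj, ?_⟩) (c - r • e) ?_ ?_ rfl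
      · intro k hk
        simp [hk, hce k hk]
      · simp [hr, div_mul_cancel₀ _ hj]
      · intro k
        rw [dotProduct_sub, hc, horth, sub_zero]
      · have hval : val ((c - r • e) i) = val (c i) := val_sub_eq_of_lt hlti
        refine not_orthogonal_iff.2 ⟨i, ?_, fun k hk => ?_⟩
        · simp only [hval]
          exact WithTop.add_ne_top.2 hi
        · simp only [hval]
          exact (hik k hk).trans_le (add_le_add_right (le_val_sub le_rfl (hle k)) _)
    · refine ih _ (hlt (r • e) ?_ ⟨m, hcm, ?_⟩) (r • e) (horth r) ?_ rfl
      · intro k hk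
        simp [hce k hk]
      · simp [hem]
      · refine not_orthogonal_iff.2 ⟨i, ?_, fun k hk => ?_⟩
        · simp only [Pi.smul_apply, smul_eq_mul, ← heq]
          exact WithTop.add_ne_top.2 hi
        · simp only [Pi.smul_apply, smul_eq_mul, ← heq]
          exact (hik k hk).trans_le (add_le_add_right (hle k) _)

/-- The circuits of a basis of `P` define the same tropical orthogonal complement as all vectors of
the orthogonal complement of `P`. -/
theorem perp_circuitVals {P : Submodule (PuiseuxSeries K) (Fin n → PuiseuxSeries K)}
    (z : Module.Basis (Fin d) (PuiseuxSeries K) P) :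
    perp (circuitVals fun k => (z k : Fin n → PuiseuxSeries K)) =
      perp (valSet (dotCompl P : Set (Fin n → PuiseuxSeries K))) := by
  have hspan : ∀ c : Fin n → PuiseuxSeries K,
      c ∈ dotCompl P ↔ ∀ k, (z k : Fin n → PuiseuxSeries K) ⬝ᵥ c = 0 := by
    intro c
    refine ⟨fun h k => h _ (z k).2, fun h x hx => ?_⟩
    have h1 := congrArg (Subtype.val) (z.sum_repr ⟨x, hx⟩)
    simp only [Submodule.coe_sum, Submodule.coe_smul] at h1
    change x ⬝ᵥ c = 0
    rw [← h1, sum_dotProduct]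
    exact Finset.sum_eq_zero fun k _ => by rw [smul_dotProduct, h, smul_zero]
  refine Set.Subset.antisymm ?_ ?_
  · rintro y hy _ ⟨c, hc, rfl⟩
    by_contra hyc
    obtain ⟨j, hj⟩ := exists_circuitVector_not_orthogonal
      (z.linearIndependent.map' P.subtype (Submodule.ker_subtype P)) y c ((hspan c).1 hc) hyc
    exact hj (hy _ ⟨j, rfl⟩)
  · rintro y hy _ ⟨j, rfl⟩
    have h := (hspan _).2 (dotProduct_circuitVector (fun k => (z k : Fin n → PuiseuxSeries K)) j)
    exact hy _ ⟨_, h, rfl⟩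

end Circuits


/-! ### Tropicalization of linear subspaces -/

section Tropicalization

variable {K : Type*} [Field K] {n : ℕ}

theorem valSet_subset_trop (X : Set (Fin n → PuiseuxSeries K)) : valSet X ⊆ Trop X := by
  rintro _ ⟨x, hx, rfl⟩
  refine Set.mem_iUnion.2 ⟨{i | x i = 0}, fun i hi => val_eq_top.2 hi,
    fun i => (val (x i)).untop (mt val_eq_top.1 i.2), subset_closure ⟨x, ⟨hx, fun i => Iff.rfl⟩,
      fun i => (WithTop.coe_untop _ _).symm⟩, fun i => (WithTop.coe_untop _ _).symm⟩

/-- Tropical orthogonality to the valuations of `X` passes to the tropicalization of `X`. -/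
theorem orthogonal_of_mem_trop {X : Set (Fin n → PuiseuxSeries K)} {a y : Fin n → RInf}
    (h : ∀ x ∈ X, Orthogonal (fun m => val (x m)) a) (hy : y ∈ Trop X) : Orthogonal y a := by
  by_contra hya
  obtain ⟨i, hi, hik⟩ := not_orthogonal_iff.1 hya
  obtain ⟨I, hyI, w, hw, hyw⟩ := Set.mem_iUnion.1 hy
  rw [WithTop.add_ne_top] at hi
  have hiI : i ∉ I := fun h => hi.1 (hyI i h)
  obtain ⟨r, hr⟩ := WithTop.ne_top_iff_exists.1 hi.2
  -- Each strict inequality persists for valuation vectors u near w in the same chart: either the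
  -- right side is ∞, or it compares two continuous real functions of u.
  have hev : ∀ k : Fin n, ∀ᶠ u in nhds w, k ≠ i → ∀ x ∈ chart K I,
      (∀ i : {i : Fin n // i ∉ I}, val (x i) = (u i : RInf)) →
        val (x i) + a i < val (x k) + a k := by
    intro k
    by_cases hki : k = i
    · exact Filter.Eventually.of_forall fun u h => (h hki).elim
    by_cases htop : k ∈ I ∨ a k = ⊤
    · refine Filter.Eventually.of_forall fun u _ x hx hu => ?_
      have h1 : val (x k) + a k = ⊤ := by
        rcases htop with hk | hk
        · rw [(hx k).2 hk, val_zero, top_add]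
        · rw [hk, add_top]
      rw [h1, hu ⟨i, hiI⟩, ← hr]
      exact WithTop.coe_lt_top _
    · push Not at htop
      obtain ⟨hkI, hk⟩ := htop
      obtain ⟨s, hs⟩ := WithTop.ne_top_iff_exists.1 hk
      have h1 := hik k hki
      rw [hyw ⟨i, hiI⟩, hyw ⟨k, hkI⟩, ← hr, ← hs, ← WithTop.coe_add, ← WithTop.coe_add,
        WithTop.coe_lt_coe] at h1
      have hc : ∀ l : {i : Fin n // i ∉ I}, ∀ t : ℝ,
          Continuous fun u : {i : Fin n // i ∉ I} → ℝ => u l + t := by fun_prop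
      filter_upwards [(isOpen_lt (hc ⟨i, hiI⟩ r) (hc ⟨k, hkI⟩ s)).mem_nhds h1] with u hu _ x hx hxu
      rw [hxu ⟨i, hiI⟩, hxu ⟨k, hkI⟩, ← hr, ← hs, ← WithTop.coe_add, ← WithTop.coe_add,
        WithTop.coe_lt_coe]
      exact hu
  obtain ⟨u, ⟨x, hx, hxu⟩, hu⟩ :=
    ((mem_closure_iff_frequently.1 hw).and_eventually (Filter.eventually_all.2 hev)).exists
  refine not_orthogonal_iff.2 ⟨i, ?_, fun k hk => hu k hk x hx.2 hxu⟩ (h x hx.1)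
  rw [hxu ⟨i, hiI⟩]
  exact WithTop.add_ne_top.2 ⟨WithTop.coe_ne_top, hi.2⟩

theorem perp_trop (X : Set (Fin n → PuiseuxSeries K)) : perp (Trop X) = perp (valSet X) := by
  refine Set.Subset.antisymm (fun y hy a ha => hy a (valSet_subset_trop X ha)) fun y hy a ha => ?_
  exact orthogonal_comm.1 <| orthogonal_of_mem_trop
    (fun x hx => orthogonal_comm.1 (hy _ ⟨x, hx, rfl⟩)) ha

/-- A term of strictly least valuation cannot be cancelled by the sum of the others. -/
theorem orthogonal_val_of_dotProduct_eq_zero {x c : Fin n → PuiseuxSeries K} (h : x ⬝ᵥ c = 0) :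
    Orthogonal (fun m => val (x m)) fun m => val (c m) := by
  classical
  by_contra hxc
  obtain ⟨i, hi, hik⟩ := not_orthogonal_iff.1 hxc
  rw [dotProduct, ← Finset.add_sum_erase _ _ (Finset.mem_univ i), add_eq_zero_iff_eq_neg] at h
  have h1 : val (x i * c i) < val (∑ k ∈ Finset.univ.erase i, x k * c k) := by
    refine lt_val_sum (by rwa [val_mul]) fun k hk => ?_
    rw [val_mul, val_mul]
    exact hik k (Finset.ne_of_mem_erase hk)
  rw [h, val_neg] at h1
  exact h1.false

/-- A subspace has a basis in reduced echelon form whose pivots are dominant with respect to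
given weights of the coordinates. -/
theorem exists_weighted_echelon (y : Fin n → ℝ)
    (W : Submodule (PuiseuxSeries K) (Fin n → PuiseuxSeries K)) :
    ∃ (B : Finset (Fin n)) (v : Fin n → Fin n → PuiseuxSeries K),
      (∀ b ∈ B, v b ∈ W ∧ v b b = 1 ∧ (∀ b' ∈ B, b' ≠ b → v b b' = 0) ∧
        ∀ k, (y k : RInf) ≤ val (v b k) + (y b : RInf)) ∧
      ∀ x ∈ W, (∀ b ∈ B, x b = 0) → x = 0 := by
  classical
  induction W using WellFoundedLT.induction with
  | _ W ih =>
  by_cases hW : W = ⊥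
  · exact ⟨∅, 0, by simp, fun x hx _ => by simpa [hW] using hx⟩
  obtain ⟨x₀, hx₀, hne⟩ := W.exists_mem_ne_zero_of_ne_bot hW
  obtain ⟨s, hs⟩ := Function.ne_iff.1 hne
  -- The pivot minimises val(x_k) - y_k over the support, where the default 0 does not occur.
  -- Normalised to 1 at a, the vector satisfies the weight bound.
  obtain ⟨a, ha, hmin⟩ := Finset.exists_min_image (Finset.univ.filter fun m => x₀ m ≠ 0)
    (fun k => (val (x₀ k)).untopD 0 - y k) ⟨s, by simpa using hs⟩
  simp only [Finset.mem_filter, Finset.mem_univ, true_and] at ha hmin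
  set x := (x₀ a)⁻¹ • x₀ with hx
  have hxW : x ∈ W := W.smul_mem _ hx₀
  have hxa : x a = 1 := inv_mul_cancel₀ ha
  have hxk : ∀ k, (y k : RInf) ≤ val (x k) + (y a : RInf) := by
    intro k
    by_cases hk : x₀ k = 0
    · simp [hx, hk]
    · have h0 : x k ≠ 0 := mul_ne_zero (inv_ne_zero ha) hk
      have h1 : x₀ k = x₀ a * x k := by simp [hx, mul_inv_cancel_left₀ ha]
      obtain ⟨p, hp⟩ := exists_val_eq_coe h0
      obtain ⟨q, hq⟩ := exists_val_eq_coe ha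
      have h2 := hmin k hk
      rw [h1, val_mul, hp, hq, ← WithTop.coe_add, WithTop.untopD_coe, WithTop.untopD_coe] at h2
      rw [hp, ← WithTop.coe_add, WithTop.coe_le_coe]
      linarith
  -- The vectors of W vanishing at a form a smaller subspace; its echelon basis already has zeros at
  -- a.
  obtain ⟨B, v, hv, hB⟩ := ih (W ⊓ LinearMap.ker (LinearMap.proj a)) (by
    refine lt_of_le_of_ne inf_le_left fun h => ?_
    have h1 : x ∈ W ⊓ LinearMap.ker (LinearMap.proj a) := h.ge hxW
    have h2 : x a = 0 := h1.2
    exact one_ne_zero (hxa.symm.trans h2))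
  have hva : ∀ b ∈ B, v b a = 0 := fun b hb => (hv b hb).1.2
  have haB : a ∉ B := fun h => one_ne_zero ((hv a h).2.1.symm.trans (hva a h))
  have hsum : ∀ b' ∈ B, ∑ b ∈ B, x b * v b b' = x b' := by
    intro b' hb'
    rw [Finset.sum_eq_single b' (fun b hb hne => by rw [(hv b hb).2.2.1 b' hb' hne.symm, mul_zero])
      (fun h => (h hb').elim), (hv b' hb').2.1, mul_one]
  -- Clearing the entries of x at the other pivots.
  let u : Fin n → PuiseuxSeries K := x - ∑ b ∈ B, x b • v b
  have hu : ∀ k, u k = x k - ∑ b ∈ B, x b * v b k := by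
    intro k
    simp [u, Finset.sum_apply]
  have hupd : ∀ b ∈ B, Function.update v a u b = v b := fun b hb =>
    Function.update_of_ne (ne_of_mem_of_not_mem hb haB) _ _
  refine ⟨insert a B, Function.update v a u, ?_, ?_⟩
  · intro b hb
    rcases Finset.mem_insert.1 hb with rfl | hbB
    · rw [Function.update_self]
      refine ⟨W.sub_mem hxW (W.sum_mem fun b hb => W.smul_mem _ (hv b hb).1.1), ?_, ?_, ?_⟩
      · rw [hu, hxa, Finset.sum_eq_zero fun c hc => by rw [hva c hc, mul_zero], sub_zero]
      · intro b' hb' hne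
        rw [hu, hsum b' ((Finset.mem_insert.1 hb').resolve_left hne), sub_self]
      · intro k
        rw [hu]
        -- With pivot a, the correction terms obey the same bound since (y_c - y_a) + (y_k - y_c) =
        -- y_k - y_a.
        have key : ((y k - y b : ℝ) : RInf) ≤ val (x k - ∑ c ∈ B, x c * v c k) := by
          have hsub : ∀ {r s : ℝ} {t : RInf}, (r : RInf) ≤ t + (s : RInf) →
              ((r - s : ℝ) : RInf) ≤ t := by
            intro r s t h
            induction t using WithTop.recTopCoe with
            | top => exact le_top
            | coe t =>
              rw [← WithTop.coe_add, WithTop.coe_le_coe] at h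
              exact WithTop.coe_le_coe.2 (by linarith)
          refine le_val_sub (hsub (hxk k)) (le_val_sum fun c hc => ?_)
          rw [val_mul]
          calc ((y k - y b : ℝ) : RInf) = ((y c - y b : ℝ) : RInf) + ((y k - y c : ℝ) : RInf) := by
                rw [← WithTop.coe_add]; congr 1; ring
            _ ≤ _ := add_le_add (hsub (hxk c)) (hsub ((hv c hc).2.2.2 k))
        calc (y k : RInf) = ((y k - y b : ℝ) : RInf) + (y b : RInf) := by
              rw [← WithTop.coe_add]; congr 1; ring
          _ ≤ _ := add_le_add_left key _
    · rw [hupd b hbB]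
      refine ⟨(hv b hbB).1.1, (hv b hbB).2.1, fun b' hb' hne => ?_, (hv b hbB).2.2.2⟩
      rcases Finset.mem_insert.1 hb' with rfl | hb'
      · exact hva b hbB
      · exact (hv b hbB).2.2.1 b' hb' hne
  · intro w hw h0
    exact hB w ⟨hw, h0 a (Finset.mem_insert_self _ _)⟩ fun b hb =>
      h0 b (Finset.mem_insert_of_mem hb)

/-- The vectors supported on a set of coordinates. -/
def supportedOn (K : Type*) [Field K] {n : ℕ} (I : Set (Fin n)) :
    Submodule (PuiseuxSeries K) (Fin n → PuiseuxSeries K) where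
  carrier := {x | ∀ i, i ∉ I → x i = 0}
  zero_mem' := fun _ _ => rfl
  add_mem' := fun {x y} hx hy i hi => by
    change x i + y i = 0
    rw [hx i hi, hy i hi, add_zero]
  smul_mem' := fun r x hx i hi => by
    change r * x i = 0
    rw [hx i hi, mul_zero]

theorem apply_eq_zero_of_mem_dotCompl_supportedOn {I : Set (Fin n)}
    {x : Fin n → PuiseuxSeries K} (hx : x ∈ dotCompl (supportedOn K I)) {i : Fin n} (hi : i ∈ I) :
    x i = 0 := by
  classical
  have h := hx (Pi.single i 1) fun k hk => Pi.single_eq_of_ne (ne_of_mem_of_not_mem hi hk).symm _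
  change Pi.single i 1 ⬝ᵥ x = 0 at h
  rwa [single_dotProduct, one_mul] at h

/-- A vector of the echelon basis of `P ∩ {x_I = 0}` that attains the weight at `k`. -/
theorem exists_echelon_eq_weight {Q : Submodule (PuiseuxSeries K) (Fin n → PuiseuxSeries K)}
    {y : Fin n → RInf} (hy : y ∈ perp (valSet (Q : Set (Fin n → PuiseuxSeries K))))
    {B : Finset (Fin n)} {v : Fin n → Fin n → PuiseuxSeries K}
    (hv : ∀ b ∈ B, v b ∈ dotCompl (Q ⊔ supportedOn K {i | y i = ⊤}) ∧ v b b = 1 ∧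
      (∀ b' ∈ B, b' ≠ b → v b b' = 0) ∧
        ∀ k, (((y k).untopD 0 : ℝ) : RInf) ≤ val (v b k) + (((y b).untopD 0 : ℝ) : RInf))
    (hB : ∀ x ∈ dotCompl (Q ⊔ supportedOn K {i | y i = ⊤}), (∀ b ∈ B, x b = 0) → x = 0)
    {k : Fin n} (hk : y k ≠ ⊤) :
    ∃ b ∈ B, val (v b k) + y b ≤ y k := by
  classical
  by_cases hkB : k ∈ B
  · exact ⟨k, hkB, by rw [(hv k hkB).2.1, val_one, zero_add]⟩
  by_contra! hlt
  -- The coefficient vector of the relation x_k = Σ x_b v_b(k), which holds on the whole echelon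
  -- space; by double complement it lies in Q plus the vectors supported where y = ∞.
  let c : Fin n → PuiseuxSeries K := Pi.single k 1 - ∑ b ∈ B, v b k • Pi.single b 1
  have hck : c k = 1 := by
    simp only [c, Pi.sub_apply, Finset.sum_apply, Pi.smul_apply, Pi.single_eq_same]
    rw [Finset.sum_eq_zero, sub_zero]
    intro b hb
    rw [Pi.single_eq_of_ne (ne_of_mem_of_not_mem hb hkB).symm, smul_zero]
  have hcb : ∀ b ∈ B, c b = -v b k := by
    intro b hb
    simp only [c, Pi.sub_apply, Finset.sum_apply, Pi.smul_apply]
    rw [Pi.single_eq_of_ne (ne_of_mem_of_not_mem hb hkB), Finset.sum_eq_single b]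
    · simp
    · intro b' _ hne
      rw [Pi.single_eq_of_ne hne.symm, smul_zero]
    · exact fun h => (h hb).elim
  have hc0 : ∀ m, m ≠ k → m ∉ B → c m = 0 := by
    intro m hmk hmB
    simp only [c, Pi.sub_apply, Finset.sum_apply, Pi.smul_apply]
    rw [Pi.single_eq_of_ne hmk, Finset.sum_eq_zero, sub_zero]
    intro b hb
    rw [Pi.single_eq_of_ne (ne_of_mem_of_not_mem hb hmB).symm, smul_zero]
  have hc : c ∈ Q ⊔ supportedOn K {i | y i = ⊤} := by
    rw [← dotCompl_dotCompl (Q ⊔ supportedOn K {i | y i = ⊤}), mem_dotCompl]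
    intro x hx
    have hexp : x - ∑ b ∈ B, x b • v b = 0 := by
      refine hB _ (Submodule.sub_mem _ hx
        (Submodule.sum_mem _ fun b hb => Submodule.smul_mem _ _ (hv b hb).1)) fun b' hb' => ?_
      simp only [Pi.sub_apply, Finset.sum_apply, Pi.smul_apply, smul_eq_mul]
      rw [Finset.sum_eq_single b'
        (fun b hb hne => by rw [(hv b hb).2.2.1 b' hb' hne.symm, mul_zero])
        (fun h => (h hb').elim), (hv b' hb').2.1, mul_one, sub_self]
    have h1 := congrFun hexp k
    simp only [Pi.sub_apply, Finset.sum_apply, Pi.smul_apply, smul_eq_mul, Pi.zero_apply] at h1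
    simp only [c, dotProduct_sub, dotProduct_sum, dotProduct_smul, dotProduct_single, mul_one,
      smul_eq_mul]
    rw [← h1]
    simp only [mul_comm]
  -- q differs from c only where y is ∞, which cannot affect a finite minimum. The assumed
  -- inequalities then make k a strict minimum of y + val(q).
  obtain ⟨q, hq, e, he, hqe⟩ := Submodule.mem_sup.1 hc
  have hqc : ∀ m, y m ≠ ⊤ → q m = c m := by
    intro m hm
    rw [← hqe, Pi.add_apply, he m hm, add_zero]
  refine not_orthogonal_iff.2 ⟨k, ?_, fun m hm => ?_⟩ (hy _ ⟨q, hq, rfl⟩)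
  · change y k + val (q k) ≠ ⊤
    rw [hqc k hk, hck, val_one, add_zero]
    exact hk
  · change y k + val (q k) < y m + val (q m)
    rw [hqc k hk, hck, val_one, add_zero]
    by_cases hmt : y m = ⊤
    · rw [hmt, top_add]
      exact hk.lt_top
    rw [hqc m hmt]
    by_cases hmB : m ∈ B
    · rw [hcb m hmB, val_neg, add_comm]
      exact hlt m hmB
    · rw [hc0 m hm hmB, val_zero, add_top]
      exact hk.lt_top

/-- Only approximation is possible, because valuations are rational while y is real; this is why the
closure is needed. Working in the complement of Q ⊔ `supportedOn K I` forces the coordinates in I to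
vanish. -/
theorem perp_valSet_subset_trop [CharZero K]
    (Q : Submodule (PuiseuxSeries K) (Fin n → PuiseuxSeries K)) :
    perp (valSet (Q : Set (Fin n → PuiseuxSeries K))) ⊆
      Trop (dotCompl Q : Set (Fin n → PuiseuxSeries K)) := by
  intro y hy
  set I : Set (Fin n) := {i | y i = ⊤}
  refine Set.mem_iUnion.2 ⟨I, fun i hi => hi, fun i => (y i).untopD 0, ?_, fun i => ?_⟩
  swap
  · change y i = (((y i).untopD 0 : ℝ) : RInf)
    obtain ⟨r, hr⟩ := WithTop.ne_top_iff_exists.1 i.2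
    rw [← hr, WithTop.untopD_coe]
  obtain ⟨B, v, hv, hB⟩ := exists_weighted_echelon (fun i => (y i).untopD 0)
    (dotCompl (Q ⊔ supportedOn K I))
  refine Metric.mem_closure_iff.2 fun ε hε => ?_
  have happrox : ∀ b : Fin n, ∃ t : PuiseuxSeries K, ∃ q : ℝ,
      val t = (q : RInf) ∧ |q - (y b).untopD 0| < ε := by
    intro b
    obtain ⟨q, hq1, hq2⟩ := exists_rat_btwn (show (y b).untopD 0 - ε < (y b).untopD 0 by linarith)
    obtain ⟨t, ht⟩ := exists_val_eq_ratCast K q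
    exact ⟨t, q, ht, abs_lt.2 ⟨by linarith, by linarith⟩⟩
  choose t q ht hq using happrox
  -- The valuation of x at i is the minimum over b of val(t_b) + val(v_b i). The echelon bound keeps
  -- it above y_i - ε, and a basis vector attaining the weight at i keeps it below y_i + ε.
  obtain ⟨x, hxW, hx⟩ := exists_mem_val_eq_inf (dotCompl (Q ⊔ supportedOn K I))
    (fun b => t b • v b) B fun b hb => Submodule.smul_mem _ _ (hv b hb).1
  have hxI : ∀ i ∈ I, x i = 0 := fun i hi => apply_eq_zero_of_mem_dotCompl_supportedOn
    (fun w hw => hxW w (Submodule.mem_sup_right hw)) hi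
  have hxval : ∀ i, i ∉ I → ∃ r : ℝ, val (x i) = (r : RInf) ∧ |r - (y i).untopD 0| < ε := by
    intro i hi
    have hlow : (((y i).untopD 0 - ε : ℝ) : RInf) < val (x i) := by
      rw [hx]
      refine (Finset.lt_inf_iff (WithTop.coe_lt_top _)).2 fun b hb => ?_
      simp only [Pi.smul_apply, smul_eq_mul, val_mul, ht]
      have h1 := (hv b hb).2.2.2 i
      generalize val (v b i) = w at h1
      induction w using WithTop.recTopCoe with
      | top => exact WithTop.coe_lt_top _
      | coe w =>
        rw [← WithTop.coe_add, WithTop.coe_le_coe] at h1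
        rw [← WithTop.coe_add, WithTop.coe_lt_coe]
        linarith [(abs_lt.1 (hq b)).1]
    have hup : val (x i) < (((y i).untopD 0 + ε : ℝ) : RInf) := by
      obtain ⟨b, hb, hle⟩ := exists_echelon_eq_weight hy hv hB hi
      rw [hx]
      refine (Finset.inf_le hb).trans_lt ?_
      simp only [Pi.smul_apply, smul_eq_mul, val_mul, ht]
      -- Finiteness of y_i makes y_b finite, so the default value in the choice of t_b is not used
      -- here.
      have hyb : val (v b i) + y b ≠ ⊤ := (hle.trans_lt (WithTop.lt_top_iff_ne_top.2 hi)).ne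
      rw [WithTop.add_ne_top] at hyb
      obtain ⟨w, hw⟩ := WithTop.ne_top_iff_exists.1 hyb.1
      obtain ⟨p, hp⟩ := WithTop.ne_top_iff_exists.1 hyb.2
      obtain ⟨r, hr⟩ := WithTop.ne_top_iff_exists.1 (show y i ≠ ⊤ from hi)
      have h2 := (abs_lt.1 (hq b)).2
      rw [← hw, ← hp, ← hr, ← WithTop.coe_add, WithTop.coe_le_coe] at hle
      rw [← hp, WithTop.untopD_coe] at h2
      rw [← hw, ← hr, WithTop.untopD_coe, ← WithTop.coe_add, WithTop.coe_lt_coe]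
      linarith
    obtain ⟨r, hr⟩ := WithTop.ne_top_iff_exists.1 (hup.trans (WithTop.coe_lt_top _)).ne
    rw [← hr, WithTop.coe_lt_coe] at hlow hup
    exact ⟨r, hr.symm, abs_lt.2 ⟨by linarith, by linarith⟩⟩
  choose r hr hrε using fun i : {i : Fin n // i ∉ I} => hxval i i.2
  refine ⟨r, ⟨x, ⟨fun w hw => hxW w (Submodule.mem_sup_left hw), fun i => ⟨fun h => ?_, hxI i⟩⟩,
    hr⟩, (dist_pi_lt_iff hε).2 fun i => ?_⟩
  · by_contra hi
    have h1 := hr ⟨i, hi⟩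
    rw [val_eq_top.2 h] at h1
    exact WithTop.top_ne_coe h1
  · rw [dist_comm, Real.dist_eq]
    exact hrε i

/-- The fundamental theorem for linear spaces: the tropicalization of the orthogonal complement of
`Q` is cut out by the valuations of the vectors of `Q`. -/
theorem trop_dotCompl [CharZero K]
    (Q : Submodule (PuiseuxSeries K) (Fin n → PuiseuxSeries K)) :
    Trop (dotCompl Q : Set (Fin n → PuiseuxSeries K)) =
      perp (valSet (Q : Set (Fin n → PuiseuxSeries K))) := by
  refine Set.Subset.antisymm ?_ (perp_valSet_subset_trop Q)
  rintro y hy _ ⟨c, hc, rfl⟩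
  refine orthogonal_of_mem_trop (fun x hx => ?_) hy
  exact orthogonal_val_of_dotProduct_eq_zero ((dotProduct_comm _ _).trans (hx c hc))

end Tropicalization

end TropLin

/-! ### The main theorem -/

theorem theorem1p9 (K : Type*) [Field K] [IsAlgClosed K] [CharZero K] (n d : ℕ)
    (P Q : Submodule (PuiseuxSeries K) (Fin n → PuiseuxSeries K))
    (hP : Module.finrank (PuiseuxSeries K) P = d)
    (hQ : Module.finrank (PuiseuxSeries K) Q = n - d)
    (hPQ : ∀ x ∈ P, ∀ y ∈ Q, x ⬝ᵥ y = 0) :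
    (∃ A : Set (Fin n → RInf), A.Finite ∧
      TropLin.Trop (P : Set (Fin n → PuiseuxSeries K)) = TropLin.perp A ∧
      TropLin.Trop (Q : Set (Fin n → PuiseuxSeries K)) = TropLin.perp (TropLin.perp A)) ∧
    ∀ (z : Module.Basis (Fin d) (PuiseuxSeries K) P) (A : Set (Fin n → RInf)),
      A = TropLin.circuitVals (fun k => (z k : Fin n → PuiseuxSeries K)) →
      A.Finite ∧
      TropLin.Trop (P : Set (Fin n → PuiseuxSeries K)) = TropLin.perp A ∧
      TropLin.Trop (Q : Set (Fin n → PuiseuxSeries K)) = TropLin.perp (TropLin.perp A) := by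
  have hQP : Q = TropLin.dotCompl P :=
    Submodule.eq_of_le_of_finrank_eq (fun y hy x hx => hPQ x hx y hy)
      (by rw [hQ, TropLin.finrank_dotCompl, hP])
  have main : ∀ z : Module.Basis (Fin d) (PuiseuxSeries K) P,
      (TropLin.circuitVals (fun k => (z k : Fin n → PuiseuxSeries K))).Finite ∧
      TropLin.Trop (P : Set (Fin n → PuiseuxSeries K)) =
        TropLin.perp (TropLin.circuitVals (fun k => (z k : Fin n → PuiseuxSeries K))) ∧
      TropLin.Trop (Q : Set (Fin n → PuiseuxSeries K)) = TropLin.perp (TropLin.perp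
        (TropLin.circuitVals (fun k => (z k : Fin n → PuiseuxSeries K)))) := by
    intro z
    have hTP : TropLin.Trop (P : Set (Fin n → PuiseuxSeries K)) =
        TropLin.perp (TropLin.circuitVals (fun k => (z k : Fin n → PuiseuxSeries K))) := by
      rw [TropLin.perp_circuitVals, ← TropLin.trop_dotCompl, TropLin.dotCompl_dotCompl]
    refine ⟨TropLin.finite_circuitVals _, hTP, ?_⟩
    -- A^⊥⊥ = Trop(P)^⊥ = val(P)^⊥, which is the tropicalization of the complement of P.
    rw [← hTP, TropLin.perp_trop, hQP, TropLin.trop_dotCompl]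
  refine ⟨⟨_, main (Module.finBasisOfFinrankEq _ _ hP)⟩, ?_⟩
  rintro z A rfl
  exact main z
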